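/- Let $p$ be a prime, $q=p^m$ ($m\ge 1$), let $\mathbb F_q$ be the field with $q$ elements, and let $\alpha_1,\dots,\alpha_q$ be an enumeration of its elements. Let $M=\begin{pmatrix}a_{11}&a_{12}\\a_{21}&a_{22}\end{pmatrix}\in \mathrm{GL}_2(\mathbb F_q)$. For an integer $k$ as below, let $$\mathrm{RL}_k(\mathbb F_q,M)=\Big\{\big(f(\alpha_1),\dots,f(\alpha_q),\,(f_{k-2},f_{k-1})M\big)\;:\; f=\sum_{i=0}^{k-1}f_ix^i\in\mathbb F_q[x]\Big\}\subseteq\mathbb F_q^{\,q+2}.$$ For a linear code $C$ of length $n$, dimension $\kappa$ and minimum Hamming distance $d$, put $S(C)=n-\kappa+1-d$, and let $C^\perp$ be its dual with respect to $\langle x,y\rangle=\sum_i x_iy_i$. The code $C$ is called near MDS (NMDS) if $S(C)=S(C^\perp)=1$. Assume that either $p=2$ and $4\le k\le q-2$, or $p\ne 2$ and $3\le k\le q$. Then $\mathrm{RL}_k(\mathbb F_q,M)$ is NMDS with parameters $[q+2,k,q+2-k]_q$, and its dual has minimum distance $k$. Moreover, let $A$ be the number of codewords of Hamming weight $q+2-k$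 in $\mathrm{RL}_k(\mathbb F_q,M)$, or the number of codewords of Hamming weight $k$ in $\mathrm{RL}_k(\mathbb F_q,M)^\perp$. In either case $A$ is given as follows. (1) If $p\nmid k-1$, then $$A=\begin{cases}\frac{2(q-1)}{q}\binom{q}{k-1}, & a_{11}a_{12}a_{21}a_{22}\ne0,\ \text{or } a_{11}a_{12}a_{21}\ne0,\ a_{22}=0,\ \text{or } a_{11}a_{12}a_{22}\ne0,\ a_{21}=0;\\[2pt] \frac{q-1}{q}\binom{q}{k-1}, & a_{11}a_{21}a_{22}\ne0,\ a_{12}=0,\ \text{or } a_{12}a_{21}a_{22}\ne0,\ a_{11}=0,\\ & \text{or } a_{12}a_{21}\ne0,\ a_{11}=a_{22}=0,\ \text{or } a_{11}a_{22}\ne0,\ a_{12}=a_{21}=0.\end{cases}$$ (2) If $p\mid k-1$, then $$A=\begin{cases}\frac{2(q-1)}{q}\binom{q}{k-1}+(-1)^{k+\frac{k-1}{p}}\frac{2(q-1)}{q}\binom{q/p}{(k-1)/p}, & a_{11}a_{12}a_{21}a_{22}\ne0;\\[2pt] \frac{2(q-1)}{q}\binom{q}{k-1}+(-1)^{k-1+\frac{k-1}{p}}\frac{q^2-3q+2}{q}\binom{q/p}{(k-1)/p},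 & a_{11}a_{12}a_{21}\ne0,\ a_{22}=0,\ \text{or } a_{11}a_{12}a_{22}\ne0,\ a_{21}=0;\\[2pt] \frac{q-1}{q}\binom{q}{k-1}+(-1)^{k+\frac{k-1}{p}}\frac{q-1}{q}\binom{q/p}{(k-1)/p}, & a_{11}a_{21}a_{22}\ne0,\ a_{12}=0,\ \text{or } a_{12}a_{21}a_{22}\ne0,\ a_{11}=0;\\[2pt] \frac{q-1}{q}\binom{q}{k-1}+(-1)^{k-1+\frac{k-1}{p}}\frac{(q-1)^2}{q}\binom{q/p}{(k-1)/p}, & a_{12}a_{21}\ne0,\ a_{11}=a_{22}=0,\ \text{or } a_{11}a_{22}\ne0,\ a_{12}=a_{21}=0.\end{cases}$$ -/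

import Mathlib

/-! Linear codes over a finite field `F` with coordinates indexed by a finite type `ι`
are the subspaces of `ι → F`; the length of such a code is the number of elements of `ι`. -/

namespace LinearCode

section Basic

variable {F ι : Type*} [Field F] [Fintype ι]

/-- The dual code with respect to the standard bilinear form `∑ i, x i * y i`. -/
def dual (C : Submodule F (ι → F)) : Submodule F (ι → F) where
  carrier := {x | ∀ y ∈ C, ∑ i, x i * y i = 0}
  add_mem' := by
    intro a b ha hb y hy
    simp only [Pi.add_apply, add_mul, Finset.sum_add_distrib]
    rw [ha y hy, hb y hy, add_zero]
  zero_mem' := by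
    intro y _
    simp
  smul_mem' := by
    intro c x hx y hy
    simp only [Pi.smul_apply, smul_eq_mul, mul_assoc, ← Finset.mul_sum]
    rw [hx y hy, mul_zero]

variable [DecidableEq F]

/-- The minimum Hamming distance between two distinct codewords
(with the value `0` for the zero code, which has no two distinct codewords). -/
noncomputable def minDist (C : Submodule F (ι → F)) : ℕ :=
  sInf {d | ∃ x ∈ C, ∃ y ∈ C, x ≠ y ∧ hammingDist x y = d}

/-- The number of codewords of Hamming weight `w`. -/
noncomputable def weightCount (C : Submodule F (ι → F)) (w : ℕ) : ℕ :=
  {c : ι → F | c ∈ C ∧ hammingNorm c = w}.ncard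

/-- `C` is an `[n, k, d]` code: length `n`, dimension `k`, minimum distance `d`. -/
structure HasParameters (C : Submodule F (ι → F)) (n k d : ℕ) : Prop where
  length_eq : Fintype.card ι = n
  finrank_eq : Module.finrank F C = k
  minDist_eq : minDist C = d

/-- The Singleton defect `n - k + 1 - d`, as an integer. -/
noncomputable def singletonDefect (C : Submodule F (ι → F)) : ℤ :=
  (Fintype.card ι : ℤ) - (Module.finrank F C : ℤ) + 1 - (minDist C : ℤ)

/-- Near MDS codes: the code and its dual both have Singleton defect `1`. -/
def IsNMDS (C : Submodule F (ι → F)) : Prop :=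
  singletonDefect C = 1 ∧ singletonDefect (dual C) = 1

end Basic

section RothLempel

variable {F : Type*} [Field F] {n l : ℕ}

/-- The word `(v₁ f(α₁), …, vₙ f(αₙ), β)` attached to a polynomial `f`, where
`β = (f_{k-l}, …, f_{k-1}) M`. The coordinates are indexed by `Fin n ⊕ Fin l`: first the
`n` evaluations, then the `l` entries of `β`. -/
noncomputable def grlWord (k : ℕ) (α : Fin n → F) (v : Fin n → Fˣ)
    (M : Matrix.GeneralLinearGroup (Fin l) F) :
    Polynomial F →ₗ[F] (Fin n ⊕ Fin l → F) where
  toFun f := Sum.elim (fun i => (v i : F) * f.eval (α i))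
    (Matrix.vecMul (fun j : Fin l => f.coeff (k - l + j)) (M : Matrix (Fin l) (Fin l) F))
  map_add' f g := by
    ext (i | j)
    · simp [mul_add]
    · simp [Matrix.vecMul, dotProduct, add_mul, Finset.sum_add_distrib]
  map_smul' c f := by
    ext (i | j)
    · simp [mul_left_comm]
    · simp [Matrix.vecMul, dotProduct, Finset.mul_sum, mul_assoc]

/-- The generalized Roth-Lempel code `GRL_k(α, v, M)`: all words attached to the
polynomials `f` of degree less than `k`. -/
noncomputable def GRL (k : ℕ) (α : Fin n → F) (v : Fin n → Fˣ)
    (M : Matrix.GeneralLinearGroup (Fin l) F) : Submodule F (Fin n ⊕ Fin l → F) :=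
  (Polynomial.degreeLT F k).map (grlWord k α v M)

/-- The code `RL_k(α, M)`: the case `v = (1, …, 1)` and `l = 2`. -/
noncomputable def RL (k : ℕ) (α : Fin n → F) (M : Matrix.GeneralLinearGroup (Fin 2) F) :
    Submodule F (Fin n ⊕ Fin 2 → F) :=
  GRL k α (fun _ => 1) M

end RothLempel

end LinearCode

/-! Weights are computed by counting zeros. A nonzero f of degree < k has at most k-1 roots, and its
tail (f_{k-2}, f_{k-1})M has at most one zero, unless both coefficients vanish; then f has at most
k-3 roots. So a nonzero word has at most k zeros, with equality exactly when f = u∏_{x∈S}(X-x) with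
u ≠ 0, #S = k-1, and some column j of M satisfies a_{2j} = a_{1j}σ, where σ is the sum of S. As det
M ≠ 0, at most one column does, so A is (q-1) times a sum of two subset-sum counts
(`weightCount_RL`, `card_minWeightSets`).

Let N(b) count the s-subsets of sum b. Scaling makes N constant on b ≠ 0, so N(0) + (q-1)N(1) =
C(q,s). For a nontrivial additive character ψ, N(0) - N(1) is the X^s coefficient of ∏(1+ψ(x)X) =
(1-(-X)^p)^{q/p}. These two equations give the Li-Wan formulas.

That the minimum weight is attained follows from a direct construction of subsets with prescribed
sum (`exists_subset_sum`). For the dual, suitable test polynomials give weights at least k, and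
comparing words supported on a k-set with words supported on its complement equates the two
minimum-weight counts (`weightCount_dual_eq`). -/

namespace LinearCode

/-! ### Duality, supports and words of minimum weight -/

section Weights

variable {F ι : Type*} [Field F]

/-- The words that vanish outside `T`. -/
def supportedOn (F : Type*) {ι : Type*} [Field F] (T : Finset ι) : Submodule F (ι → F) where
  carrier := {x | ∀ i, i ∉ T → x i = 0}
  add_mem' ha hb i hi := by simp [ha i hi, hb i hi]
  zero_mem' i _ := rfl
  smul_mem' c x hx i hi := by simp [hx i hi]

theorem mem_supportedOn {T : Finset ι} {x : ι → F} :
    x ∈ supportedOn F T ↔ ∀ i, i ∉ T → x i = 0 := Iff.rfl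

theorem finrank_supportedOn (T : Finset ι) :
    Module.finrank F (supportedOn F T) = T.card := by
  classical
  have h : supportedOn F T = ⨅ i ∈ (T : Set ι)ᶜ,
      LinearMap.ker (LinearMap.proj i : (ι → F) →ₗ[F] F) := by
    ext x
    simp [mem_supportedOn]
  rw [h]
  have e := LinearMap.iInfKerProjEquiv F (fun _ : ι => F) (I := (T : Set ι))
    (J := (T : Set ι)ᶜ) disjoint_compl_right (by simp)
  have := e.finrank_eq
  simpa using this

variable [Fintype ι]

theorem mem_dual {C : Submodule F (ι → F)} {x : ι → F} :
    x ∈ dual C ↔ ∀ y ∈ C, ∑ i, x i * y i = 0 := Iff.rfl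

/-- The standard bilinear form on words. -/
noncomputable def stdForm (F ι : Type*) [Field F] [Fintype ι] [DecidableEq ι] :
    LinearMap.BilinForm F (ι → F) := Matrix.toBilin' 1

theorem stdForm_apply [DecidableEq ι] (x y : ι → F) : stdForm F ι x y = ∑ i, x i * y i := by
  simp [stdForm, Matrix.toBilin'_apply', dotProduct]

theorem stdForm_nondegenerate [DecidableEq ι] : (stdForm F ι).Nondegenerate :=
  
  LinearMap.BilinForm.nondegenerate_toBilin'_of_det_ne_zero' 1 (by simp)

theorem dual_eq_orthogonal [DecidableEq ι] (C : Submodule F (ι → F)) :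
    dual C = (stdForm F ι).orthogonal C := by
  ext x
  simp [mem_dual, LinearMap.BilinForm.mem_orthogonal_iff, stdForm_apply, mul_comm]

theorem finrank_dual (C : Submodule F (ι → F)) :
    Module.finrank F (dual C) = Fintype.card ι - Module.finrank F C := by
  classical
  rw [dual_eq_orthogonal, LinearMap.BilinForm.finrank_orthogonal stdForm_nondegenerate,
    Module.finrank_fintype_fun_eq_card]

theorem dual_sup (C D : Submodule F (ι → F)) : dual (C ⊔ D) = dual C ⊓ dual D := by
  ext x
  constructor
  · exact fun h => ⟨fun y hy => h y (Submodule.mem_sup_left hy),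
      fun y hy => h y (Submodule.mem_sup_right hy)⟩
  · rintro ⟨h1, h2⟩ y hy
    obtain ⟨a, ha, b, hb, rfl⟩ := Submodule.mem_sup.1 hy
    simp [mul_add, Finset.sum_add_distrib, h1 a ha, h2 b hb]

theorem dual_supportedOn [DecidableEq ι] (T : Finset ι) :
    dual (supportedOn F T) = supportedOn F Tᶜ := by
  ext x
  constructor
  · intro h i hi
    have := h (Pi.single i 1) (fun j hj => by
      have : j ≠ i := by rintro rfl; simp_all
      simp [this])
    simpa [Pi.single_apply] using this
  · intro h y hy
    refine Finset.sum_eq_zero fun i _ => ?_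
    by_cases hi : i ∈ T
    · rw [h i (by simpa using hi), zero_mul]
    · rw [hy i hi, mul_zero]

/-- Shortening the dual code to `T` and the code to the complement of `T`. -/
theorem finrank_dual_inf_supportedOn [DecidableEq ι] (C : Submodule F (ι → F)) (T : Finset ι) :
    Module.finrank F ↥(dual C ⊓ supportedOn F T) + Module.finrank F C =
      T.card + Module.finrank F ↥(C ⊓ supportedOn F Tᶜ) := by
  -- The left intersection is the dual of `C ⊔ supportedOn F Tᶜ`, so its dimension comes from that
  -- of the sum.
  have h1 := Submodule.finrank_sup_add_finrank_inf_eq C (supportedOn F Tᶜ)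
  have h2 := finrank_dual (C ⊔ supportedOn F Tᶜ)
  rw [dual_sup, dual_supportedOn, compl_compl] at h2
  have h3 := Submodule.finrank_le (C ⊔ supportedOn F Tᶜ)
  rw [Module.finrank_fintype_fun_eq_card] at h3
  rw [finrank_supportedOn, Finset.card_compl] at h1
  have h4 := Finset.card_le_univ T
  omega

variable [DecidableEq F]

theorem minDist_eq_of_weights {C : Submodule F (ι → F)} {d : ℕ}
    (hle : ∀ x ∈ C, x ≠ 0 → d ≤ hammingNorm x) (hex : ∃ x ∈ C, x ≠ 0 ∧ hammingNorm x = d) :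
    minDist C = d := by
  obtain ⟨x, hx, hx0, hxd⟩ := hex
  apply le_antisymm
  · exact Nat.sInf_le ⟨x, hx, 0, C.zero_mem, hx0, by rw [hammingDist_zero_right, hxd]⟩
  · refine le_csInf ⟨d, x, hx, 0, C.zero_mem, hx0, by rw [hammingDist_zero_right, hxd]⟩ ?_
    rintro _ ⟨y, hy, z, hz, hne, rfl⟩
    rw [hammingDist_eq_hammingNorm]
    exact hle _ (C.add_mem (C.neg_mem hy) hz) fun h => hne (neg_add_eq_zero.1 h)

theorem minDist_eq_of_weightCount_ne_zero {C : Submodule F (ι → F)} {d : ℕ}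
    (hd : 0 < d) (hle : ∀ x ∈ C, x ≠ 0 → d ≤ hammingNorm x) (h : weightCount C d ≠ 0) :
    minDist C = d := by
  obtain ⟨x, hx, hxd⟩ := Set.nonempty_of_ncard_ne_zero h
  refine minDist_eq_of_weights hle ⟨x, hx, ?_, hxd⟩
  rintro rfl
  rw [hammingNorm_zero] at hxd
  omega

/-- If no nonzero word is lighter than `w`, then the words of weight `w` are the nonzero words
supported on `w`-sets. -/
theorem weightCount_eq_sum [Fintype F] [DecidableEq ι] {C : Submodule F (ι → F)} {w : ℕ}
    (hw : 0 < w) (hle : ∀ x ∈ C, x ≠ 0 → w ≤ hammingNorm x) :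
    weightCount C w = ∑ T ∈ Finset.powersetCard w (Finset.univ : Finset ι),
      (Nat.card ↥(C ⊓ supportedOn F T) - 1) := by
  classical
  have h1 : {c : ι → F | c ∈ C ∧ hammingNorm c = w} =
      ((Finset.univ.filter fun c : ι → F => c ∈ C ∧ hammingNorm c = w : Finset (ι → F)) :
        Set (ι → F)) := by ext; simp
  rw [weightCount, h1, Set.ncard_coe_finset]
  rw [Finset.card_eq_sum_card_fiberwise
    (f := fun c : ι → F => (Finset.univ.filter fun i => c i ≠ 0))
    (t := Finset.powersetCard w (Finset.univ : Finset ι))]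
  · refine Finset.sum_congr rfl fun T hT => ?_
    have hT' : T.card = w := (Finset.mem_powersetCard.1 hT).2
    have h2 : Nat.card ↥(C ⊓ supportedOn F T) =
        (Finset.univ.filter fun c : ι → F => c ∈ C ⊓ supportedOn F T).card := by
      rw [Nat.card_eq_fintype_card, Fintype.card_subtype]
    rw [h2, ← Finset.card_erase_of_mem (a := (0 : ι → F)) (by simp)]
    congr 1
    ext c
    simp only [Finset.mem_filter, Finset.mem_univ, true_and, Finset.mem_erase, Submodule.mem_inf]
    constructor
    · rintro ⟨⟨hc, hcw⟩, rfl⟩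
      refine ⟨?_, hc, fun i hi => by simpa using hi⟩
      rintro rfl
      simp at hcw
      omega
    · rintro ⟨hc0, hc, hs⟩
      have hsub : (Finset.univ.filter fun i => c i ≠ 0) ⊆ T := by
        intro i hi
        by_contra hiT
        exact (Finset.mem_filter.1 hi).2 (hs i hiT)
      -- Minimality of `w` forces the support to fill `T`, so each word is counted for one `T` only.
      have hcard : T.card ≤ (Finset.univ.filter fun i => c i ≠ 0).card := by
        rw [hT']; exact hle c hc hc0
      have heq := Finset.eq_of_subset_of_card_le hsub hcard
      refine ⟨⟨hc, ?_⟩, heq⟩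
      rw [← hT', ← heq]; rfl
  · intro c hc
    simp only [Finset.coe_filter, Finset.mem_univ, true_and, Set.mem_ofPred_eq] at hc
    simp only [Finset.mem_coe, Finset.mem_powersetCard, Finset.subset_univ, true_and]
    exact hc.2

/-- If a code of dimension `k` has weights at least `n - k` and its dual has weights at least `k`,
then both have the same number of words of these weights. -/
theorem weightCount_dual_eq [Fintype F] {C : Submodule F (ι → F)} {k : ℕ}
    (hk : Module.finrank F C = k) (hk0 : 0 < k) (hkn : k < Fintype.card ι)
    (hC : ∀ x ∈ C, x ≠ 0 → Fintype.card ι - k ≤ hammingNorm x)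
    (hD : ∀ x ∈ dual C, x ≠ 0 → k ≤ hammingNorm x) :
    weightCount (dual C) k = weightCount C (Fintype.card ι - k) := by
  classical
  rw [weightCount_eq_sum hk0 hD, weightCount_eq_sum (by omega) hC]
  refine Finset.sum_nbij' (fun T => Tᶜ) (fun T => Tᶜ) ?_ ?_ (by simp) (by simp) ?_
  · intro T hT
    have := (Finset.mem_powersetCard.1 hT).2
    simp [Finset.mem_powersetCard, Finset.card_compl, this]
  · intro T hT
    have := (Finset.mem_powersetCard.1 hT).2
    simp only [Finset.mem_powersetCard, Finset.card_compl, this, Finset.subset_univ, true_and]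
    omega
  · intro T hT
    -- Since `T` has exactly dim C elements, the two shortened codes have equal dimension.
    have h := finrank_dual_inf_supportedOn C T
    rw [hk, (Finset.mem_powersetCard.1 hT).2] at h
    rw [Module.natCard_eq_pow_finrank (K := F) (V := ↥(dual C ⊓ supportedOn F T)),
      Module.natCard_eq_pow_finrank (K := F) (V := ↥(C ⊓ supportedOn F Tᶜ)),
      show Module.finrank F ↥(dual C ⊓ supportedOn F T) =
        Module.finrank F ↥(C ⊓ supportedOn F Tᶜ) by omega]

end Weights

end LinearCode

/-! ### Counting subsets of a finite field by their sum -/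

section SubsetSums

open Finset

variable {F : Type*} [Field F] [Fintype F] [DecidableEq F]

/-- The number of `s`-subsets of `F` with sum `b`. -/
def subsetSumCount (F : Type*) [Field F] [Fintype F] [DecidableEq F] (s : ℕ) (b : F) : ℕ :=
  #{S ∈ powersetCard s (univ : Finset F) | ∑ x ∈ S, x = b}

theorem subsetSumCount_mul (s : ℕ) {c : F} (hc : c ≠ 0) (b : F) :
    subsetSumCount F s (c * b) = subsetSumCount F s b := by
  refine card_nbij' (fun S => S.map (Equiv.mulLeft₀ c hc).symm.toEmbedding)
    (fun S => S.map (Equiv.mulLeft₀ c hc).toEmbedding) ?_ ?_ ?_ ?_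
  · intro S hS
    simp only [coe_filter, mem_powersetCard, subset_univ, true_and, Set.mem_ofPred_eq] at hS ⊢
    rw [card_map, sum_map]
    refine ⟨hS.1, ?_⟩
    simp only [Equiv.coe_toEmbedding, Equiv.mulLeft₀_symm_apply]
    rw [← mul_sum, hS.2, inv_mul_cancel_left₀ hc]
  · intro S hS
    simp only [coe_filter, mem_powersetCard, subset_univ, true_and, Set.mem_ofPred_eq] at hS ⊢
    rw [card_map, sum_map]
    refine ⟨hS.1, ?_⟩
    simp only [Equiv.coe_toEmbedding, Equiv.mulLeft₀_apply]
    rw [← mul_sum, hS.2]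
  · intro S _
    ext x
    simp [hc]
  · intro S _
    ext x
    simp [hc]

theorem subsetSumCount_eq_one (s : ℕ) {b : F} (hb : b ≠ 0) :
    subsetSumCount F s b = subsetSumCount F s (1 : F) := by
  simpa using subsetSumCount_mul s hb (1 : F)

theorem sum_subsetSumCount (s : ℕ) :
    ∑ b : F, subsetSumCount F s b = (Fintype.card F).choose s := by
  simp only [subsetSumCount]
  rw [← card_eq_sum_card_fiberwise (fun _ _ => mem_coe.2 (mem_univ _)), card_powersetCard,
    card_univ]

theorem subsetSumCount_zero_add (s : ℕ) :
    subsetSumCount F s (0 : F) + (Fintype.card F - 1) * subsetSumCount F s (1 : F) =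
      (Fintype.card F).choose s := by
  rw [← sum_subsetSumCount, ← add_sum_erase _ _ (mem_univ (0 : F)),
    sum_congr rfl fun b hb => subsetSumCount_eq_one s (ne_of_mem_erase hb)]
  simp [card_erase_of_mem]

theorem exists_addChar_ne_one (F : Type*) [Field F] [Fintype F] : ∃ ψ : AddChar F ℂ, ψ ≠ 1 := by
  obtain ⟨ψ, h⟩ := AddChar.exists_apply_ne_zero.2 (one_ne_zero (α := F))
  exact ⟨ψ, fun h' => h (by simp [h'])⟩

/-- Group the subsets by their sum b: the count is constant on b ≠ 0, and the values ψ(b) there add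
up to -1. -/
theorem sum_powersetCard_addChar {ψ : AddChar F ℂ} (hψ : ψ ≠ 1) (s : ℕ) :
    ∑ S ∈ powersetCard s (univ : Finset F), ∏ x ∈ S, ψ x =
      (subsetSumCount F s (0 : F) : ℂ) - subsetSumCount F s (1 : F) := by
  have h1 : ∑ S ∈ powersetCard s (univ : Finset F), ∏ x ∈ S, ψ x =
      ∑ b : F, (subsetSumCount F s b : ℂ) * ψ b := by
    rw [← sum_fiberwise_of_maps_to (t := (univ : Finset F)) (g := fun S => ∑ x ∈ S, x)
      (fun _ _ => mem_univ _)]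
    refine sum_congr rfl fun b _ => ?_
    rw [subsetSumCount, ← nsmul_eq_mul]
    refine sum_eq_card_nsmul fun S hS => ?_
    rw [← (mem_filter.1 hS).2]
    exact (map_prod ψ.toMonoidHom (fun x => Multiplicative.ofAdd x) S).symm
  have h2 := AddChar.sum_eq_zero_of_ne_one hψ
  rw [← add_sum_erase _ _ (mem_univ (0 : F))] at h1 h2
  rw [h1, sum_congr rfl fun b hb => by rw [subsetSumCount_eq_one s (ne_of_mem_erase hb)],
    ← mul_sum, eq_neg_of_add_eq_zero_right h2]
  simp [sub_eq_add_neg]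

open Polynomial in
theorem coeff_prod_one_add {R ι : Type*} [CommRing R] (t : Finset ι) (f : ι → R) (s : ℕ) :
    (∏ x ∈ t, (1 + C (f x) * X : R[X])).coeff s = ∑ S ∈ powersetCard s t, ∏ x ∈ S, f x := by
  classical
  rw [prod_one_add, finsetSum_coeff]
  have h : ∀ S : Finset ι, (∏ x ∈ S, (C (f x) * X : R[X])).coeff s =
      if #S = s then ∏ x ∈ S, f x else 0 := by
    intro S
    rw [prod_mul_distrib, prod_const, ← map_prod, coeff_C_mul_X_pow]
    simp [eq_comm]
  simp_rw [h]
  rw [← sum_filter, powersetCard_eq_filter]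

theorem addChar_pow_char {F : Type*} [Field F] (p : ℕ) [CharP F p] (ψ : AddChar F ℂ) (x : F) : ψ x ^ p = 1 := by
  rw [← AddChar.map_nsmul_eq_pow, nsmul_eq_mul, CharP.cast_eq_zero, zero_mul,
    AddChar.map_zero_eq_one]

/-- A nontrivial additive character takes every `p`-th root of unity equally often. -/
theorem card_addChar_fiber {F : Type*} [Field F] [Fintype F] (p : ℕ) [CharP F p]
    {ψ : AddChar F ℂ} (hψ : ψ ≠ 1) {ζ : ℂ}
    (hζ : ζ ∈ Polynomial.nthRootsFinset p (1 : ℂ)) :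
    #{x : F | ψ x = ζ} = Fintype.card F / p := by
  have hp : p.Prime := CharP.char_is_prime F p
  obtain ⟨a, ha⟩ : ∃ a, ψ a ≠ 1 := by
    by_contra! h
    exact hψ (by ext x; simp [h x])
  have := Fact.mk hp
  have hprim : IsPrimitiveRoot (ψ a) p :=
    IsPrimitiveRoot.iff_orderOf.2 (orderOf_eq_prime (addChar_pow_char p ψ a) ha)
  have key : ∀ ζ ∈ Polynomial.nthRootsFinset p (1 : ℂ),
      #{x : F | ψ x = ζ} = #{x : F | ψ x = 1} := by
    intro ζ hζ
    rw [Polynomial.mem_nthRootsFinset hp.pos] at hζ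
    obtain ⟨i, _, rfl⟩ := hprim.eq_pow_of_pow_eq_one hζ
    have hne : ψ a ^ i ≠ 0 := fun h => by rw [h, zero_pow hp.ne_zero] at hζ; exact zero_ne_one hζ
    -- Translation by `i • a` carries the kernel of ψ onto the fibre over `ψ a ^ i`.
    refine card_nbij' (fun x => x - i • a) (fun x => x + i • a) ?_ ?_ ?_ ?_
    · intro x hx
      simp only [coe_filter, mem_univ, true_and, Set.mem_ofPred_eq] at hx ⊢
      rw [AddChar.map_sub_eq_div, AddChar.map_nsmul_eq_pow, hx, div_self hne]
    · intro x hx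
      simp only [coe_filter, mem_univ, true_and, Set.mem_ofPred_eq] at hx ⊢
      rw [AddChar.map_add_eq_mul, AddChar.map_nsmul_eq_pow, hx, one_mul]
    · intro x _; simp
    · intro x _; simp
  have hsum : Fintype.card F = p * #{x : F | ψ x = 1} := by
    rw [← card_univ, card_eq_sum_card_fiberwise (f := ψ)
      (t := Polynomial.nthRootsFinset p (1 : ℂ)), sum_congr rfl key, sum_const,
      hprim.card_nthRootsFinset, smul_eq_mul]
    intro x _
    simpa [Polynomial.mem_nthRootsFinset hp.pos] using addChar_pow_char p ψ x
  rw [key ζ hζ, hsum, Nat.mul_div_cancel_left _ hp.pos]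

open Polynomial in
-- Each p-th root of unity ζ is a value of ψ exactly q/p times, and ∏(1 + ζX) = 1 - (-X)^p.
theorem prod_one_add_addChar {F : Type*} [Field F] [Fintype F] (p : ℕ) [CharP F p]
    {ψ : AddChar F ℂ} (hψ : ψ ≠ 1) :
    ∏ x : F, (1 + C (ψ x) * X : ℂ[X]) = (1 - (-X) ^ p) ^ (Fintype.card F / p) := by
  have hp : p.Prime := CharP.char_is_prime F p
  have := Fact.mk hp
  rw [← prod_fiberwise_of_maps_to (t := nthRootsFinset p (1 : ℂ)) (g := ψ)
    (fun x _ => (mem_nthRootsFinset hp.pos _).2 (addChar_pow_char p ψ x))]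
  have h : ∀ ζ ∈ nthRootsFinset p (1 : ℂ),
      ∏ x ∈ univ with ψ x = ζ, (1 + C (ψ x) * X : ℂ[X]) =
        (1 + C ζ * X) ^ (Fintype.card F / p) := by
    intro ζ hζ
    rw [← card_addChar_fiber p hψ hζ]
    exact prod_eq_pow_card fun x hx => by rw [(mem_filter.1 hx).2]
  rw [prod_congr rfl h, prod_pow]
  congr 1
  refine Polynomial.funext fun t => ?_
  have h2 := (Complex.isPrimitiveRoot_exp p hp.ne_zero).pow_sub_pow_eq_prod_sub_mul 1 (-t) hp.pos
  simp only [eval_prod, eval_add, eval_one, eval_mul, eval_C, eval_X, eval_sub, eval_pow, eval_neg]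
  rw [one_pow] at h2
  rw [h2]
  exact prod_congr rfl fun ζ _ => by ring

open Polynomial in
theorem coeff_one_sub_neg_X_pow {p : ℕ} (hp : 0 < p) (m s : ℕ) :
    ((1 - (-X) ^ p : ℂ[X]) ^ m).coeff s =
      if p ∣ s then (-1) ^ (s + s / p) * (m.choose (s / p) : ℂ) else 0 := by
  have h : (1 - (-X) ^ p : ℂ[X]) = 1 + C (-(-1) ^ p) * X ^ p := by
    rw [neg_pow (X : ℂ[X]) p]
    simp [sub_eq_add_neg]
  -- A polynomial in X^p: only exponents s = pj survive, with sign (-(-1)^p)^j = (-1)^(s+j).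
  have h2 : (1 - (-X) ^ p : ℂ[X]) ^ m = expand ℂ p ((1 + C (-(-1) ^ p) * X) ^ m) := by
    simp [h]
  rw [h2, coeff_expand hp]
  split_ifs with hd
  · obtain ⟨j, rfl⟩ := hd
    rw [Nat.mul_div_cancel_left _ hp]
    have h3 : ((1 + C (-(-1) ^ p) * X : ℂ[X]) ^ m) = ((1 + X) ^ m).comp (C (-(-1) ^ p) * X) := by
      simp
    rw [h3, comp_C_mul_X_coeff, coeff_one_add_X_pow, neg_pow, ← pow_mul, pow_add]
    ring
  · rfl

variable (p : ℕ) [CharP F p]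

/-- The difference between the numbers of `s`-subsets with sum `0` and with sum `1`. -/
theorem subsetSumCount_zero_sub_one (s : ℕ) :
    (subsetSumCount F s (0 : F) : ℚ) - subsetSumCount F s (1 : F) =
      if p ∣ s then (-1) ^ (s + s / p) * ((Fintype.card F / p).choose (s / p) : ℚ) else 0 := by
  obtain ⟨ψ, hψ⟩ := exists_addChar_ne_one F
  have h := sum_powersetCard_addChar hψ s
  rw [← coeff_prod_one_add, prod_one_add_addChar p hψ,
    coeff_one_sub_neg_X_pow (CharP.char_is_prime F p).pos] at h
  split_ifs at h ⊢ with hd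
  · have : (((subsetSumCount F s (0 : F) : ℚ) - subsetSumCount F s (1 : F) : ℚ) : ℂ) =
      (((-1) ^ (s + s / p) * ((Fintype.card F / p).choose (s / p) : ℚ) : ℚ) : ℂ) := by
      push_cast; exact h.symm
    exact_mod_cast this
  · have : (((subsetSumCount F s (0 : F) : ℚ) - subsetSumCount F s (1 : F) : ℚ) : ℂ) =
      ((0 : ℚ) : ℂ) := by
      push_cast; exact h.symm
    exact_mod_cast this

/-- The Li-Wan formula for nonzero sums. -/
theorem card_mul_subsetSumCount_of_ne_zero (s : ℕ) {b : F} (hb : b ≠ 0) :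
    (Fintype.card F : ℚ) * subsetSumCount F s b = (Fintype.card F).choose s -
      if p ∣ s then (-1) ^ (s + s / p) * ((Fintype.card F / p).choose (s / p) : ℚ) else 0 := by
  -- q N(1) = (N(0) + (q-1)N(1)) - (N(0) - N(1)).
  rw [subsetSumCount_eq_one s hb, ← subsetSumCount_zero_sub_one p s,
    ← subsetSumCount_zero_add (F := F)]
  push_cast [Nat.cast_sub (Fintype.card_pos (α := F))]
  ring

/-- The Li-Wan formula for the sum zero. -/
theorem card_mul_subsetSumCount_zero (s : ℕ) :
    (Fintype.card F : ℚ) * subsetSumCount F s (0 : F) = (Fintype.card F).choose s +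
      (Fintype.card F - 1) *
      if p ∣ s then (-1) ^ (s + s / p) * ((Fintype.card F / p).choose (s / p) : ℚ) else 0 := by
  rw [← subsetSumCount_zero_sub_one p s, ← subsetSumCount_zero_add (F := F)]
  push_cast [Nat.cast_sub (Fintype.card_pos (α := F))]
  ring

end SubsetSums

/-! ### Subsets with a prescribed sum exist -/

section SubsetSumExistence

open Finset

variable {F : Type*} [Field F] [Fintype F] [DecidableEq F]

/-- Removing either of two distinct elements from an (s+1)-set leaves different sums. -/
theorem exists_subset_sum_ne {s : ℕ} (hs : 1 ≤ s) (hs' : s < Fintype.card F) (b : F) :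
    ∃ V : Finset F, #V = s ∧ ∑ x ∈ V, x ≠ b := by
  obtain ⟨W, -, hW⟩ := exists_subset_card_eq (s := (univ : Finset F)) (n := s + 1)
    (by rw [card_univ]; omega)
  obtain ⟨x, hx, y, hy, hxy⟩ := one_lt_card.1 (show 1 < #W by omega)
  by_contra! h
  have h1 := h (W.erase x) (by rw [card_erase_of_mem hx]; omega)
  have h2 := h (W.erase y) (by rw [card_erase_of_mem hy]; omega)
  have h3 := add_sum_erase W (fun z => z) hx
  have h4 := add_sum_erase W (fun z => z) hy
  simp only [h1, h2] at h3 h4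
  exact hxy (add_right_cancel (h3.trans h4.symm))

/-- With z = e - y, the element y must avoid V, e - V and the solutions of 2y = e: at most 2#V + 1
values, given that 2 ≠ 0 or e ≠ 0. -/
theorem exists_pair_sum {V : Finset F} (hV : 2 * #V + 1 < Fintype.card F) {e : F}
    (h : (2 : F) ≠ 0 ∨ e ≠ 0) : ∃ y z, y ∉ V ∧ z ∉ V ∧ y ≠ z ∧ y + z = e := by
  have hB : #{y : F | 2 * y = e} ≤ 1 := by
    refine card_le_one.2 fun a ha b hb => ?_
    simp only [mem_filter, mem_univ, true_and] at ha hb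
    by_cases h2 : (2 : F) = 0
    · rw [h2, zero_mul] at ha
      exact absurd ha.symm (h.resolve_left (not_not.2 h2))
    · exact mul_left_cancel₀ h2 (ha.trans hb.symm)
  have hA : #(V.image fun x => e - x) ≤ #V := card_image_le
  have hU := (card_union_le (V ∪ V.image fun x => e - x) {y : F | 2 * y = e}).trans
    (Nat.add_le_add_right (card_union_le _ _) _)
  obtain ⟨y, hy⟩ : ∃ y, y ∉ (V ∪ V.image fun x => e - x) ∪ ({y : F | 2 * y = e} : Finset F) := by
    by_contra! hall
    have := card_le_card (fun y _ => hall y : (univ : Finset F) ⊆ _)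
    rw [card_univ] at this
    omega
  simp only [mem_union, mem_image, mem_filter, mem_univ, true_and, not_or, not_exists,
    not_and] at hy
  refine ⟨y, e - y, hy.1.1, fun h => hy.1.2 _ h (by ring), fun h => hy.2 ?_, by ring⟩
  linear_combination h

/-- Choose s-2 elements and complete them by a pair with the missing sum. In characteristic 2 that
sum must be nonzero, which takes some freedom in the first choice, hence s ≥ 3. -/
theorem exists_subset_sum_of_small {s : ℕ} (hs : 2 ≤ s) (hs' : 2 * s < Fintype.card F + 3)
    (h : (2 : F) ≠ 0 ∨ 3 ≤ s ∧ s ≤ Fintype.card F) (b : F) :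
    ∃ S : Finset F, #S = s ∧ ∑ x ∈ S, x = b := by
  obtain ⟨V, hV, hVb⟩ : ∃ V : Finset F, #V = s - 2 ∧ ((2 : F) ≠ 0 ∨ b - ∑ x ∈ V, x ≠ 0) := by
    rcases h with h | ⟨h, h'⟩
    · obtain ⟨V, -, hV⟩ := exists_subset_card_eq (s := (univ : Finset F)) (n := s - 2)
        (by rw [card_univ]; omega)
      exact ⟨V, hV, Or.inl h⟩
    · obtain ⟨V, hV, hb⟩ := exists_subset_sum_ne (s := s - 2) (by omega) (by omega) b
      exact ⟨V, hV, Or.inr (sub_ne_zero.2 hb.symm)⟩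
  obtain ⟨y, z, hy, hz, hyz, he⟩ := exists_pair_sum (V := V) (by omega) hVb
  have hy' : y ∉ insert z V := by simp [hyz, hy]
  refine ⟨insert y (insert z V), ?_, ?_⟩
  · rw [card_insert_of_notMem hy', card_insert_of_notMem hz]; omega
  · rw [sum_insert hy', sum_insert hz]
    linear_combination he

theorem exists_subset_sum {s : ℕ} (h : (2 : F) ≠ 0 ∧ 2 ≤ s ∧ s + 1 ≤ Fintype.card F ∨
    3 ≤ s ∧ s + 3 ≤ Fintype.card F) (b : F) :
    ∃ S : Finset F, #S = s ∧ ∑ x ∈ S, x = b := by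
  by_cases hs : 2 * s < Fintype.card F + 3
  · refine exists_subset_sum_of_small (by omega) hs ?_ b
    rcases h with h | h
    · exact Or.inl h.1
    · exact Or.inr ⟨h.1, by omega⟩
  -- Large sets are complements of small ones, whose target sum is the total minus `b`.
  · obtain ⟨S, hS, hSb⟩ : ∃ S : Finset F,
        #S = Fintype.card F - s ∧ ∑ x ∈ S, x = ∑ x, x - b := by
      by_cases h1 : Fintype.card F - s = 1
      · exact ⟨{∑ x, x - b}, by rw [h1, card_singleton], sum_singleton _ _⟩
      · refine exists_subset_sum_of_small (by omega) (by omega) ?_ _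
        rcases h with h | h
        · exact Or.inl h.1
        · exact Or.inr ⟨by omega, by omega⟩
    refine ⟨Sᶜ, by rw [card_compl, hS]; omega, ?_⟩
    have := sum_add_sum_compl S (fun x => x)
    rw [hSb] at this
    linear_combination this

end SubsetSumExistence

namespace LinearCode

/-! ### Zeros of Roth-Lempel words and the minimum weight -/

section RothLempelWeights

open Finset Polynomial

variable {F : Type*} [Field F] {k : ℕ}

/-- The last two entries of a word of a Roth-Lempel code. -/
noncomputable def rlTail (k : ℕ) (M : Matrix.GeneralLinearGroup (Fin 2) F) (f : F[X]) :
    Fin 2 → F :=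
  Matrix.vecMul ![f.coeff (k - 2), f.coeff (k - 1)] (M : Matrix (Fin 2) (Fin 2) F)

theorem rlTail_apply (M : Matrix.GeneralLinearGroup (Fin 2) F) (f : F[X]) (j : Fin 2) :
    rlTail k M f j = f.coeff (k - 2) * M.val 0 j + f.coeff (k - 1) * M.val 1 j := by
  simp [rlTail, Matrix.vecMul, dotProduct, Fin.sum_univ_two]

theorem rlTail_eq_zero_iff (M : Matrix.GeneralLinearGroup (Fin 2) F) (f : F[X]) :
    rlTail k M f = 0 ↔ f.coeff (k - 2) = 0 ∧ f.coeff (k - 1) = 0 := by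
  rw [rlTail, ← Matrix.zero_vecMul M.val,
    (Matrix.vecMul_injective_of_isUnit M.isUnit).eq_iff, funext_iff, Fin.forall_fin_two]
  simp

variable {n : ℕ}

theorem grlWord_inl (α : Fin n → F) (M : Matrix.GeneralLinearGroup (Fin 2) F) (f : F[X])
    (i : Fin n) : grlWord k α (fun _ => 1) M f (Sum.inl i) = f.eval (α i) := by
  simp [grlWord]

theorem grlWord_inr (hk : 2 ≤ k) (α : Fin n → F) (M : Matrix.GeneralLinearGroup (Fin 2) F)
    (f : F[X]) (j : Fin 2) :
    grlWord k α (fun _ => 1) M f (Sum.inr j) = rlTail k M f j := by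
  have h : k - 2 + 1 = k - 1 := by omega
  rw [rlTail_apply]
  simp [grlWord, Matrix.vecMul, dotProduct, Fin.sum_univ_two, h]

theorem mem_RL {α : Fin n → F} {M : Matrix.GeneralLinearGroup (Fin 2) F} {c : Fin n ⊕ Fin 2 → F} :
    c ∈ RL k α M ↔ ∃ f : F[X], f.degree < k ∧ grlWord k α (fun _ => 1) M f = c := by
  simp [RL, GRL, Submodule.mem_map, mem_degreeLT]

/-- The monic polynomial with simple roots exactly on `S`. -/
noncomputable def rootPoly (S : Finset F) : F[X] := ∏ x ∈ S, (X - C x)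

theorem rootPoly_monic (S : Finset F) : (rootPoly S).Monic := monic_prod_X_sub_C _ _

theorem natDegree_rootPoly (S : Finset F) : (rootPoly S).natDegree = #S :=
  natDegree_finsetProd_X_sub_C_eq_card S _

theorem eval_rootPoly_eq_zero {S : Finset F} {x : F} : (rootPoly S).eval x = 0 ↔ x ∈ S := by
  simp [rootPoly, eval_prod, prod_eq_zero_iff, sub_eq_zero]

theorem degree_rootPoly (S : Finset F) : (rootPoly S).degree = #S := by
  rw [degree_eq_natDegree (rootPoly_monic S).ne_zero, natDegree_rootPoly]

theorem coeff_card_rootPoly (S : Finset F) : (rootPoly S).coeff #S = 1 := by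
  have := (rootPoly_monic S).coeff_natDegree
  rwa [natDegree_rootPoly] at this

theorem coeff_card_pred_rootPoly {S : Finset F} (hS : 0 < #S) :
    (rootPoly S).coeff (#S - 1) = -∑ x ∈ S, x :=
  prod_X_sub_C_coeff_card_pred S (fun x => x) hS

/-- By Vieta the top two coefficients are u and -u times the sum of S; this turns a zero in the tail
into a subset-sum condition. -/
theorem rlTail_C_mul_rootPoly (hk : 2 ≤ k) (M : Matrix.GeneralLinearGroup (Fin 2) F) (u : F)
    {S : Finset F} (hS : #S = k - 1) (j : Fin 2) :
    rlTail k M (C u * rootPoly S) j = u * (M.val 1 j - M.val 0 j * ∑ x ∈ S, x) := by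
  have h1 := coeff_card_rootPoly S
  have h2 := coeff_card_pred_rootPoly (S := S) (by omega)
  rw [hS] at h1 h2
  rw [rlTail_apply, coeff_C_mul, coeff_C_mul, h1, show k - 2 = k - 1 - 1 by omega, h2]
  ring

theorem degree_C_mul_rootPoly_lt (hk : 0 < k) (u : F) {S : Finset F} (hS : #S = k - 1) :
    (C u * rootPoly S).degree < k := by
  rw [degree_lt_iff_coeff_zero]
  intro m hm
  rw [coeff_C_mul, coeff_eq_zero_of_natDegree_lt (by rw [natDegree_rootPoly]; omega), mul_zero]

theorem card_zeros_rlTail_le [DecidableEq F] {M : Matrix.GeneralLinearGroup (Fin 2) F} {f : F[X]}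
    (h : rlTail k M f ≠ 0) : #{j | rlTail k M f j = 0} ≤ 1 := by
  by_contra! hc
  refine h (funext fun j => ?_)
  have := eq_univ_of_card ({j | rlTail k M f j = 0} : Finset (Fin 2))
    (le_antisymm (card_le_univ _) (by rwa [Fintype.card_fin]))
  simpa using this.symm.le (mem_univ j)

variable [Fintype F]

theorem card_zeros_le_natDegree [DecidableEq F] {f : F[X]} (hf : f ≠ 0) :
    #{x | f.eval x = 0} ≤ f.natDegree :=
  card_le_degree_of_subset_roots fun x hx => by
    simp only [filter_val, Multiset.mem_filter] at hx
    exact (mem_roots hf).2 hx.2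

/-- The difference of the two sides is divisible by the root polynomial of degree k-1, yet has
smaller degree. -/
theorem eq_C_mul_rootPoly [DecidableEq F] {f : F[X]} (hf : f.degree < k)
    (hc : #{x | f.eval x = 0} = k - 1) (hk : 0 < k) :
    f = C (f.coeff (k - 1)) * rootPoly {x | f.eval x = 0} := by
  have hdvd : rootPoly {x | f.eval x = 0} ∣ f := by
    by_cases h0 : f = 0
    · rw [h0]; exact dvd_zero _
    · exact (Multiset.prod_X_sub_C_dvd_iff_le_roots h0 _).2
        ((Multiset.le_iff_subset (nodup _)).2 fun x hx => (mem_roots h0).2 (by simpa using hx))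
  have h1 : rootPoly {x | f.eval x = 0} ∣
      f - C (f.coeff (k - 1)) * rootPoly {x | f.eval x = 0} :=
    dvd_sub hdvd (dvd_mul_left _ _)
  refine sub_eq_zero.1 (eq_zero_of_dvd_of_degree_lt h1 ?_)
  rw [degree_rootPoly, hc, degree_lt_iff_coeff_zero]
  intro m hm
  rw [coeff_sub, coeff_C_mul]
  rcases hm.eq_or_lt with rfl | hm
  · rw [← hc, coeff_card_rootPoly, mul_one, sub_self]
  · rw [coeff_eq_zero_of_degree_lt (hf.trans_le (by exact_mod_cast (by omega : k ≤ m))),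
      coeff_eq_zero_of_natDegree_lt (p := rootPoly _) (by rw [natDegree_rootPoly, hc]; exact hm)]
    simp

variable [DecidableEq F]

theorem hammingNorm_add_zeros (hk : 2 ≤ k) {α : Fin n → F} (hα : Function.Bijective α)
    (M : Matrix.GeneralLinearGroup (Fin 2) F) (f : F[X]) :
    hammingNorm (grlWord k α (fun _ => 1) M f) +
      (#{x | f.eval x = 0} + #{j | rlTail k M f j = 0}) = n + 2 := by
  have h1 : #{x | f.eval x = 0} = #{i | f.eval (α i) = 0} := by
    rw [card_filter, card_filter]
    exact (hα.sum_comp fun x => if f.eval x = 0 then 1 else 0).symm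
  have h2 : hammingNorm (grlWord k α (fun _ => 1) M f) =
      #{i | ¬ f.eval (α i) = 0} + #{j | ¬ rlTail k M f j = 0} := by
    rw [hammingNorm, card_filter, card_filter, card_filter, Fintype.sum_sum_type]
    simp only [grlWord_inl, grlWord_inr hk, ne_eq]
  have h3 := card_filter_add_card_filter_not (s := (univ : Finset (Fin n)))
    (fun i => f.eval (α i) = 0)
  have h4 := card_filter_add_card_filter_not (s := (univ : Finset (Fin 2)))
    (fun j => rlTail k M f j = 0)
  rw [card_univ, Fintype.card_fin] at h3 h4
  omega

/-- Invertibility of M kills both top coefficients: at most k-3 roots remain, plus two tail zeros.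
-/
theorem card_zeros_of_rlTail_eq_zero (hk : 3 ≤ k) {M : Matrix.GeneralLinearGroup (Fin 2) F}
    {f : F[X]} (hf : f.degree < k) (hf0 : f ≠ 0) (h : rlTail k M f = 0) :
    #{x | f.eval x = 0} + #{j | rlTail k M f j = 0} < k := by
  obtain ⟨h2, h1⟩ := (rlTail_eq_zero_iff M f).1 h
  have hd : f.degree < ((k - 2 : ℕ) : WithBot ℕ) := by
    rw [degree_lt_iff_coeff_zero] at hf ⊢
    intro m hm
    rcases (by omega : m = k - 2 ∨ m = k - 1 ∨ k ≤ m) with rfl | rfl | hm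
    exacts [h2, h1, hf m hm]
  have h3 := (natDegree_lt_iff_degree_lt hf0).2 hd
  have h4 := card_zeros_le_natDegree hf0
  have h5 := card_le_univ ({j | rlTail k M f j = 0} : Finset (Fin 2))
  rw [Fintype.card_fin] at h5
  omega

theorem card_zeros_le (hk : 3 ≤ k) (M : Matrix.GeneralLinearGroup (Fin 2) F)
    {f : F[X]} (hf : f.degree < k) (hf0 : f ≠ 0) :
    #{x | f.eval x = 0} + #{j | rlTail k M f j = 0} ≤ k := by
  by_cases h : rlTail k M f = 0
  · exact (card_zeros_of_rlTail_eq_zero hk hf hf0 h).le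
  · have h3 := (natDegree_lt_iff_degree_lt hf0).2 hf
    have h4 := card_zeros_le_natDegree hf0
    have h5 := card_zeros_rlTail_le h
    omega

theorem grlWord_injOn (hk : 3 ≤ k) (hkn : k ≤ n) {α : Fin n → F} (hα : Function.Bijective α)
    (M : Matrix.GeneralLinearGroup (Fin 2) F) {f g : F[X]} (hf : f.degree < k) (hg : g.degree < k)
    (h : grlWord k α (fun _ => 1) M f = grlWord k α (fun _ => 1) M g) : f = g := by
  by_contra hne
  have h1 := card_zeros_le hk M ((degree_sub_le f g).trans_lt (max_lt hf hg)) (sub_ne_zero.2 hne)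
  have h2 := hammingNorm_add_zeros (by omega : 2 ≤ k) hα M (f - g)
  rw [map_sub, h, sub_self, hammingNorm_zero] at h2
  omega

theorem finrank_RL (hk : 3 ≤ k) (hkn : k ≤ n) {α : Fin n → F} (hα : Function.Bijective α)
    (M : Matrix.GeneralLinearGroup (Fin 2) F) : Module.finrank F (RL k α M) = k := by
  have hinj : Function.Injective ((grlWord k α (fun _ => 1) M).domRestrict (degreeLT F k)) := by
    rintro ⟨f, hf⟩ ⟨g, hg⟩ h
    exact Subtype.ext (grlWord_injOn hk hkn hα M (mem_degreeLT.1 hf) (mem_degreeLT.1 hg) h)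
  rw [RL, GRL, ← LinearMap.range_domRestrict, LinearMap.finrank_range_of_inj hinj,
    (degreeLTEquiv F k).finrank_eq, Module.finrank_fin_fun]

theorem le_hammingNorm_RL (hk : 3 ≤ k) {α : Fin n → F} (hα : Function.Bijective α)
    {M : Matrix.GeneralLinearGroup (Fin 2) F} {c : Fin n ⊕ Fin 2 → F} (hc : c ∈ RL k α M)
    (hc0 : c ≠ 0) : n + 2 - k ≤ hammingNorm c := by
  obtain ⟨f, hf, rfl⟩ := mem_RL.1 hc
  have h1 := card_zeros_le hk M hf (by rintro rfl; exact hc0 (map_zero _))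
  have h2 := hammingNorm_add_zeros (by omega : 2 ≤ k) hα M f
  omega

/-- The `(k - 1)`-sets `S` for which the multiples of `rootPoly S` have minimum weight. -/
def minWeightSets (k : ℕ) (M : Matrix.GeneralLinearGroup (Fin 2) F) : Finset (Finset F) :=
  {S ∈ powersetCard (k - 1) univ | ∃ j, M.val 1 j = M.val 0 j * ∑ x ∈ S, x}

/-- Exactly k zeros can only arise as k-1 roots and one tail zero. -/
theorem hammingNorm_eq_iff (hk : 3 ≤ k) (hkn : k ≤ n) {α : Fin n → F} (hα : Function.Bijective α)
    (M : Matrix.GeneralLinearGroup (Fin 2) F) {f : F[X]} (hf : f.degree < k) :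
    hammingNorm (grlWord k α (fun _ => 1) M f) = n + 2 - k ↔
      ∃ u : Fˣ, ∃ S ∈ minWeightSets k M, C (u : F) * rootPoly S = f := by
  have hw := hammingNorm_add_zeros (by omega : 2 ≤ k) hα M f
  constructor
  · intro h
    have hf0 : f ≠ 0 := by
      rintro rfl
      rw [map_zero, hammingNorm_zero] at h
      omega
    have ht : rlTail k M f ≠ 0 := fun h0 => by
      have := card_zeros_of_rlTail_eq_zero hk hf hf0 h0
      omega
    have h3 := (natDegree_lt_iff_degree_lt hf0).2 hf
    have h4 := card_zeros_le_natDegree hf0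
    have h5 := card_zeros_rlTail_le ht
    have hc : #{x | f.eval x = 0} = k - 1 := by omega
    have heq := eq_C_mul_rootPoly hf hc (by omega)
    have hu : f.coeff (k - 1) ≠ 0 := fun h0 => hf0 (by rw [heq, h0, C_0, zero_mul])
    refine ⟨Units.mk0 _ hu, _, ?_, heq.symm⟩
    obtain ⟨j, hj⟩ := card_pos.1 (show 0 < #{j | rlTail k M f j = 0} by omega)
    refine mem_filter.2 ⟨mem_powersetCard.2 ⟨subset_univ _, hc⟩, j, ?_⟩
    rw [mem_filter, heq, rlTail_C_mul_rootPoly (by omega) M _ hc, mul_eq_zero,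
      or_iff_right hu, sub_eq_zero] at hj
    exact hj.2
  · rintro ⟨u, S, hS, rfl⟩
    obtain ⟨hS, j, hj⟩ := mem_filter.1 hS
    have hS := (mem_powersetCard.1 hS).2
    have h1 : ({x | (C (u : F) * rootPoly S).eval x = 0} : Finset F) = S := by
      ext x
      simp [eval_rootPoly_eq_zero]
    have h2 : 0 < #{j | rlTail k M (C (u : F) * rootPoly S) j = 0} :=
      card_pos.2 ⟨j, mem_filter.2 ⟨mem_univ _, by
        rw [rlTail_C_mul_rootPoly (by omega) M _ hS, sub_eq_zero.2 hj, mul_zero]⟩⟩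
    have h3 := card_zeros_le hk M hf
      (mul_ne_zero (C_ne_zero.2 u.ne_zero) (rootPoly_monic S).ne_zero)
    rw [h1] at hw h3
    omega

theorem weightCount_RL (hk : 3 ≤ k) (hkn : k ≤ n) {α : Fin n → F} (hα : Function.Bijective α)
    (M : Matrix.GeneralLinearGroup (Fin 2) F) :
    weightCount (RL k α M) (n + 2 - k) = (Fintype.card F - 1) * #(minWeightSets k M) := by
  have hset : {c | c ∈ RL k α M ∧ hammingNorm c = n + 2 - k} =
      (((univ : Finset Fˣ) ×ˢ minWeightSets k M).image fun z =>
        grlWord k α (fun _ => 1) M (C (z.1 : F) * rootPoly z.2) :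
          Finset (Fin n ⊕ Fin 2 → F)) := by
    ext c
    simp only [Set.mem_ofPred_eq, coe_image, Set.mem_image, mem_coe, mem_product, mem_univ,
      true_and, Prod.exists]
    constructor
    · rintro ⟨hc, hw⟩
      obtain ⟨f, hf, rfl⟩ := mem_RL.1 hc
      obtain ⟨u, S, hS, rfl⟩ := (hammingNorm_eq_iff hk hkn hα M hf).1 hw
      exact ⟨u, S, hS, rfl⟩
    · rintro ⟨u, S, hS, rfl⟩
      have hd := degree_C_mul_rootPoly_lt (by omega : 0 < k) (u : F)
        (mem_powersetCard.1 (mem_filter.1 hS).1).2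
      exact ⟨mem_RL.2 ⟨_, hd, rfl⟩, (hammingNorm_eq_iff hk hkn hα M hd).2 ⟨u, S, hS, rfl⟩⟩
  rw [weightCount, hset, Set.ncard_coe_finset, card_image_of_injOn, card_product, card_univ,
    Fintype.card_units]
  -- The pair is recovered from the word: S as the root set of the polynomial, u as its leading
  -- coefficient.
  rintro ⟨u, S⟩ hz ⟨v, T⟩ hw h
  have hS := (mem_powersetCard.1 (mem_filter.1 (mem_product.1 hz).2).1).2
  have hT := (mem_powersetCard.1 (mem_filter.1 (mem_product.1 hw).2).1).2
  have heq := grlWord_injOn hk hkn hα M (degree_C_mul_rootPoly_lt (by omega) (u : F) hS)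
    (degree_C_mul_rootPoly_lt (by omega) (v : F) hT) h
  have hST : S = T := by
    ext x
    have := congrArg (eval x) heq
    simp only [eval_mul, eval_C] at this
    rw [← eval_rootPoly_eq_zero, ← eval_rootPoly_eq_zero (S := T)]
    constructor
    · intro hx; rw [hx, mul_zero] at this; simpa using this.symm
    · intro hx; rw [hx, mul_zero] at this; simpa using this
  subst hST
  have huv := C_injective (mul_right_cancel₀ (rootPoly_monic S).ne_zero heq)
  rw [Units.ext huv]

end RothLempelWeights

end LinearCode

namespace LinearCode

/-! ### Lower bound for the weights of the dual -/

section RothLempelDual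

open Finset Polynomial

variable {F : Type*} [Field F] {k n : ℕ}

/-- The last two coefficients can be prescribed along with `k - 2` roots. -/
theorem exists_rlTail_eq [Fintype F] (hk : 3 ≤ k) (hkF : k ≤ Fintype.card F) {S : Finset F}
    (hS : #S ≤ k - 2) (u v : F) : ∃ f : F[X], f.degree < k ∧ (∀ x ∈ S, f.eval x = 0) ∧
      f.coeff (k - 2) = u ∧ f.coeff (k - 1) = v := by
  obtain ⟨T, hST, -, hT⟩ := exists_subsuperset_card_eq (subset_univ S) hS
    (by rw [card_univ]; omega)
  have h1 := coeff_card_rootPoly T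
  have h2 := coeff_card_pred_rootPoly (S := T) (by omega)
  rw [hT] at h1 h2
  have h0 : ∀ m, k - 2 < m → (rootPoly T).coeff m = 0 := fun m hm =>
    coeff_eq_zero_of_natDegree_lt (by rwa [natDegree_rootPoly, hT])
  -- The term `v * ∑ x ∈ T, x` cancels the contribution of the second coefficient of `rootPoly T` in
  -- degree k-2.
  refine ⟨(C v * X + C (u + v * ∑ x ∈ T, x)) * rootPoly T, ?_, ?_, ?_, ?_⟩
  · rw [degree_lt_iff_coeff_zero]
    intro m hm
    obtain ⟨m, rfl⟩ := Nat.exists_eq_add_of_lt (show 0 < m by omega)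
    rw [add_mul, coeff_add, mul_assoc, coeff_C_mul, coeff_C_mul, coeff_X_mul, h0 _ (by omega),
      h0 _ (by omega)]
    simp
  · intro x hx
    rw [eval_mul, eval_rootPoly_eq_zero.2 (hST hx), mul_zero]
  · rw [show k - 2 = k - 2 - 1 + 1 by omega, add_mul, coeff_add, mul_assoc, coeff_C_mul,
      coeff_C_mul, coeff_X_mul, h2, show k - 2 - 1 + 1 = k - 2 by omega, h1]
    ring
  · rw [show k - 1 = k - 2 + 1 by omega, add_mul, coeff_add, mul_assoc, coeff_C_mul,
      coeff_C_mul, coeff_X_mul, h1, h0 _ (by omega)]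
    ring

theorem mem_dual_RL (hk : 2 ≤ k) {α : Fin n → F} {M : Matrix.GeneralLinearGroup (Fin 2) F}
    {x : Fin n ⊕ Fin 2 → F} : x ∈ dual (RL k α M) ↔ ∀ f : F[X], f.degree < k →
      ∑ i, x (Sum.inl i) * f.eval (α i) + ∑ j, x (Sum.inr j) * rlTail k M f j = 0 := by
  have h : ∀ f : F[X], ∑ i, x i * grlWord k α (fun _ => 1) M f i =
      ∑ i, x (Sum.inl i) * f.eval (α i) + ∑ j, x (Sum.inr j) * rlTail k M f j := by
    intro f
    rw [Fintype.sum_sum_type]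
    simp only [grlWord_inl, grlWord_inr hk]
  constructor
  · intro hx f hf
    rw [← h]
    exact hx _ (mem_RL.2 ⟨f, hf, rfl⟩)
  · intro hx c hc
    obtain ⟨f, hf, rfl⟩ := mem_RL.1 hc
    rw [h]
    exact hx f hf

variable [Fintype F] [DecidableEq F]

/-- Testing against polynomials that vanish on the support but have arbitrary top coefficients shows
that M annihilates the tail of x. -/
theorem inr_eq_zero_of_mem_dual_RL (hk : 3 ≤ k) (hkF : k ≤ Fintype.card F) {α : Fin n → F}
    {M : Matrix.GeneralLinearGroup (Fin 2) F} {x : Fin n ⊕ Fin 2 → F} (hx : x ∈ dual (RL k α M))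
    (hS : #{i | x (Sum.inl i) ≠ 0} ≤ k - 2) (j : Fin 2) : x (Sum.inr j) = 0 := by
  have key : ∀ u v : F, ∑ j, x (Sum.inr j) * (u * M.val 0 j + v * M.val 1 j) = 0 := by
    intro u v
    obtain ⟨f, hf, hz, hu, hv⟩ := exists_rlTail_eq hk hkF
      (S := ({i | x (Sum.inl i) ≠ 0} : Finset (Fin n)).image α) (card_image_le.trans hS) u v
    have := (mem_dual_RL (by omega)).1 hx f hf
    rw [sum_eq_zero fun i _ => ?_, zero_add] at this
    · simpa only [rlTail_apply, hu, hv] using this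
    · by_cases hi : x (Sum.inl i) = 0
      · rw [hi, zero_mul]
      · rw [hz _ (mem_image_of_mem _ (by simpa using hi)), mul_zero]
  have hM : Matrix.mulVec M.val (fun j => x (Sum.inr j)) = Matrix.mulVec M.val 0 := by
    rw [Matrix.mulVec_zero]
    funext i
    have h1 := key 1 0
    have h2 := key 0 1
    simp only [one_mul, zero_mul, add_zero, zero_add] at h1 h2
    fin_cases i
    · simpa [Matrix.mulVec, dotProduct, mul_comm] using h1
    · simpa [Matrix.mulVec, dotProduct, mul_comm] using h2
  exact congrFun (Matrix.mulVec_injective_of_isUnit M.isUnit hM) j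

theorem le_hammingNorm_dual_RL (hk : 3 ≤ k) (hkF : k ≤ Fintype.card F) {α : Fin n → F}
    (hα : Function.Injective α) {M : Matrix.GeneralLinearGroup (Fin 2) F}
    {x : Fin n ⊕ Fin 2 → F} (hx : x ∈ dual (RL k α M)) (hx0 : x ≠ 0) : k ≤ hammingNorm x := by
  by_contra! hlt
  have hw : hammingNorm x = #{i | x (Sum.inl i) ≠ 0} + #{j | x (Sum.inr j) ≠ 0} := by
    rw [hammingNorm, card_filter, card_filter, card_filter, Fintype.sum_sum_type]
  have ht : ∀ j, x (Sum.inr j) = 0 := by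
    by_cases hS : #{i | x (Sum.inl i) ≠ 0} ≤ k - 2
    · exact inr_eq_zero_of_mem_dual_RL hk hkF hx hS
    · intro j
      by_contra hj
      have : 0 < #{j | x (Sum.inr j) ≠ 0} := card_pos.2 ⟨j, by simpa using hj⟩
      omega
  have hl : ∀ i, x (Sum.inl i) = 0 := by
    intro i
    by_contra hi
    -- `rootPoly T` vanishes at every other support point, so orthogonality to its word isolates `x
    -- (Sum.inl i)`.
    set T := (({i | x (Sum.inl i) ≠ 0} : Finset (Fin n)).erase i).image α with hT
    have hTk : #T < k := by
      have h1 : #T ≤ _ := card_image_le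
      have h2 := card_erase_le (s := ({i | x (Sum.inl i) ≠ 0} : Finset (Fin n))) (a := i)
      omega
    have := (mem_dual_RL (by omega)).1 hx (rootPoly T)
      (by rw [degree_rootPoly]; exact_mod_cast hTk)
    rw [sum_eq_single i, sum_eq_zero fun j _ => by rw [ht j, zero_mul], add_zero, mul_eq_zero,
      or_iff_right hi, eval_rootPoly_eq_zero, hT, mem_image] at this
    · obtain ⟨a, ha, hai⟩ := this
      exact ne_of_mem_erase ha (hα hai)
    · intro b _ hb
      by_cases hxb : x (Sum.inl b) = 0
      · rw [hxb, zero_mul]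
      · rw [eval_rootPoly_eq_zero.2, mul_zero]
        exact mem_image_of_mem _ (mem_erase.2 ⟨hb, by simpa using hxb⟩)
    · simp
  exact hx0 (funext fun i => i.rec hl ht)

end RothLempelDual

/-! ### Minimum-weight words as subset-sum counts -/

section RothLempelCount

open Finset

variable {F : Type*} [Field F] [Fintype F] [DecidableEq F]

/-- The number of `s`-subsets of `F` whose sum `σ` satisfies `b = a * σ`. -/
def scaledSumCount (s : ℕ) (a b : F) : ℕ :=
  #{S ∈ powersetCard s (univ : Finset F) | b = a * ∑ x ∈ S, x}

theorem scaledSumCount_of_eq_zero (s : ℕ) {a b : F} (ha : a = 0) (hb : b ≠ 0) :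
    scaledSumCount s a b = 0 := by
  simp [scaledSumCount, ha, hb]

theorem scaledSumCount_of_ne_zero (s : ℕ) {a : F} (b : F) (ha : a ≠ 0) :
    scaledSumCount s a b = subsetSumCount F s (b / a) := by
  rw [scaledSumCount, subsetSumCount]
  congr 1
  ext S
  simp [eq_div_iff ha, mul_comm, eq_comm]

/-- If both columns met the condition for the same S, the rows of M would be proportional and det M
= 0. -/
theorem card_minWeightSets {k : ℕ} (M : Matrix.GeneralLinearGroup (Fin 2) F) :
    #(minWeightSets k M) = scaledSumCount (k - 1) (M.val 0 0) (M.val 1 0) +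
      scaledSumCount (k - 1) (M.val 0 1) (M.val 1 1) := by
  rw [scaledSumCount, scaledSumCount, ← card_union_of_disjoint]
  · congr 1
    ext S
    simp only [minWeightSets, Fin.exists_fin_two, mem_filter, mem_union]
    tauto
  · rw [disjoint_filter]
    intro S _ h1 h2
    have hdet : M.val.det ≠ 0 := ((Matrix.isUnit_iff_isUnit_det _).1 M.isUnit).ne_zero
    apply hdet
    rw [Matrix.det_fin_two, h1, h2]
    ring

theorem minWeightSets_pos {k : ℕ} (hk : (2 : F) ≠ 0 ∧ 3 ≤ k ∧ k ≤ Fintype.card F ∨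
    4 ≤ k ∧ k + 2 ≤ Fintype.card F) (M : Matrix.GeneralLinearGroup (Fin 2) F) :
    0 < #(minWeightSets k M) := by
  have hdet : M.val.det ≠ 0 := ((Matrix.isUnit_iff_isUnit_det _).1 M.isUnit).ne_zero
  obtain ⟨j, hj⟩ : ∃ j, M.val 0 j ≠ 0 := by
    by_contra! h
    exact hdet (by rw [Matrix.det_fin_two, h, h]; ring)
  obtain ⟨S, hS, hb⟩ := exists_subset_sum (s := k - 1) (hk.imp (fun h => ⟨h.1, by omega, by omega⟩)
    fun h => ⟨by omega, by omega⟩) (M.val 1 j / M.val 0 j)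
  refine card_pos.2 ⟨S, mem_filter.2 ⟨mem_powersetCard.2 ⟨subset_univ _, hS⟩, j, ?_⟩⟩
  rw [hb, mul_div_cancel₀ _ hj]

end RothLempelCount

end LinearCode

namespace LinearCode

/-! ### Equality of the two counts and the column formulas -/

section RothLempelNMDS

variable {F : Type*} [Field F] [Fintype F] [DecidableEq F] {k n : ℕ}

theorem weightCount_dual_RL (hk : 3 ≤ k) (hkF : k ≤ Fintype.card F) (hkn : k ≤ n) {α : Fin n → F}
    (hα : Function.Bijective α) (M : Matrix.GeneralLinearGroup (Fin 2) F) :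
    weightCount (dual (RL k α M)) k = weightCount (RL k α M) (n + 2 - k) := by
  have hcard : Fintype.card (Fin n ⊕ Fin 2) = n + 2 := by simp
  rw [← hcard]
  refine weightCount_dual_eq (finrank_RL hk hkn hα M) (by omega) (by omega) (fun c hc hc0 => ?_)
    fun x hx hx0 => le_hammingNorm_dual_RL hk hkF hα.1 hx hx0
  rw [hcard]
  exact le_hammingNorm_RL hk hα hc hc0

variable (p : ℕ) [CharP F p]

theorem card_mul_scaledSumCount_of_ne_zero (s : ℕ) {a b : F} (ha : a ≠ 0) (hb : b ≠ 0) :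
    (Fintype.card F : ℚ) * scaledSumCount s a b = (Fintype.card F).choose s -
      if p ∣ s then (-1) ^ (s + s / p) * ((Fintype.card F / p).choose (s / p) : ℚ) else 0 := by
  rw [scaledSumCount_of_ne_zero s b ha,
    card_mul_subsetSumCount_of_ne_zero p s (div_ne_zero hb ha)]

theorem card_mul_scaledSumCount_zero (s : ℕ) {a b : F} (ha : a ≠ 0) (hb : b = 0) :
    (Fintype.card F : ℚ) * scaledSumCount s a b = (Fintype.card F).choose s +
      (Fintype.card F - 1) *
      if p ∣ s then (-1) ^ (s + s / p) * ((Fintype.card F / p).choose (s / p) : ℚ) else 0 := by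
  rw [scaledSumCount_of_ne_zero s b ha, hb, zero_div, card_mul_subsetSumCount_zero p s]

end RothLempelNMDS

end LinearCode

/-! ### Parameters, near MDS property and the case formulas -/

theorem mainTheorem2 {F : Type*} [Field F] [Fintype F] [DecidableEq F]
    (p q k : ℕ) [CharP F p] (hq : Fintype.card F = q)
    (hk : (p = 2 ∧ 4 ≤ k ∧ k ≤ q - 2) ∨ (p ≠ 2 ∧ 3 ≤ k ∧ k ≤ q))
    (α : Fin q → F) (hα : Function.Injective α)
    (M : Matrix.GeneralLinearGroup (Fin 2) F)
    (a₁₁ a₁₂ a₂₁ a₂₂ : F)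
    (hM : (M : Matrix (Fin 2) (Fin 2) F) = !![a₁₁, a₁₂; a₂₁, a₂₂]) :
    LinearCode.IsNMDS (LinearCode.RL k α M) ∧
    LinearCode.HasParameters (LinearCode.RL k α M) (q + 2) k (q + 2 - k) ∧
    LinearCode.minDist (LinearCode.dual (LinearCode.RL k α M)) = k ∧
    (∀ A : ℚ,
      (A = (LinearCode.weightCount (LinearCode.RL k α M) (q + 2 - k) : ℚ) ∨
        A = (LinearCode.weightCount (LinearCode.dual (LinearCode.RL k α M)) k : ℚ)) →
      (¬ p ∣ k - 1 →
        ((a₁₁ * a₁₂ * a₂₁ * a₂₂ ≠ 0 ∨ (a₁₁ * a₁₂ * a₂₁ ≠ 0 ∧ a₂₂ = 0) ∨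
            (a₁₁ * a₁₂ * a₂₂ ≠ 0 ∧ a₂₁ = 0)) →
          A = 2 * ((q : ℚ) - 1) / q * (q.choose (k - 1) : ℚ)) ∧
        (((a₁₁ * a₂₁ * a₂₂ ≠ 0 ∧ a₁₂ = 0) ∨ (a₁₂ * a₂₁ * a₂₂ ≠ 0 ∧ a₁₁ = 0) ∨
            (a₁₂ * a₂₁ ≠ 0 ∧ a₁₁ = 0 ∧ a₂₂ = 0) ∨
            (a₁₁ * a₂₂ ≠ 0 ∧ a₁₂ = 0 ∧ a₂₁ = 0)) →
          A = ((q : ℚ) - 1) / q * (q.choose (k - 1) : ℚ))) ∧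
      (p ∣ k - 1 →
        (a₁₁ * a₁₂ * a₂₁ * a₂₂ ≠ 0 →
          A = 2 * ((q : ℚ) - 1) / q * (q.choose (k - 1) : ℚ) +
            (-1) ^ (k + (k - 1) / p) * (2 * ((q : ℚ) - 1) / q) *
              ((q / p).choose ((k - 1) / p) : ℚ)) ∧
        (((a₁₁ * a₁₂ * a₂₁ ≠ 0 ∧ a₂₂ = 0) ∨ (a₁₁ * a₁₂ * a₂₂ ≠ 0 ∧ a₂₁ = 0)) →
          A = 2 * ((q : ℚ) - 1) / q * (q.choose (k - 1) : ℚ) +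
            (-1) ^ (k - 1 + (k - 1) / p) * (((q : ℚ) ^ 2 - 3 * q + 2) / q) *
              ((q / p).choose ((k - 1) / p) : ℚ)) ∧
        (((a₁₁ * a₂₁ * a₂₂ ≠ 0 ∧ a₁₂ = 0) ∨ (a₁₂ * a₂₁ * a₂₂ ≠ 0 ∧ a₁₁ = 0)) →
          A = ((q : ℚ) - 1) / q * (q.choose (k - 1) : ℚ) +
            (-1) ^ (k + (k - 1) / p) * (((q : ℚ) - 1) / q) *
              ((q / p).choose ((k - 1) / p) : ℚ)) ∧
        (((a₁₂ * a₂₁ ≠ 0 ∧ a₁₁ = 0 ∧ a₂₂ = 0) ∨ (a₁₁ * a₂₂ ≠ 0 ∧ a₁₂ = 0 ∧ a₂₁ = 0)) →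
          A = ((q : ℚ) - 1) / q * (q.choose (k - 1) : ℚ) +
            (-1) ^ (k - 1 + (k - 1) / p) * (((q : ℚ) - 1) ^ 2 / q) *
              ((q / p).choose ((k - 1) / p) : ℚ)))) := by
  subst hq
  have hp : p.Prime := CharP.char_is_prime F p
  have hcases : (2 : F) ≠ 0 ∧ 3 ≤ k ∧ k ≤ Fintype.card F ∨ 4 ≤ k ∧ k + 2 ≤ Fintype.card F := by
    rcases hk with ⟨-, h1, h2⟩ | ⟨hp2, h1, h2⟩
    · exact Or.inr ⟨h1, by omega⟩
    · refine Or.inl ⟨fun h => hp2 ?_, h1, h2⟩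
      have h2 : p ∣ 2 := (CharP.cast_eq_zero_iff F p 2).1 (by exact_mod_cast h)
      exact (Nat.prime_dvd_prime_iff_eq hp Nat.prime_two).1 h2
  have hk3 : 3 ≤ k := by omega
  have hkq : k ≤ Fintype.card F := by omega
  have hα' : Function.Bijective α :=
    (Fintype.bijective_iff_injective_and_card α).2 ⟨hα, Fintype.card_fin _⟩
  have hq1 : 1 < Fintype.card F := Fintype.one_lt_card
  have hcount := LinearCode.weightCount_RL hk3 hkq hα' M
  have hdual := LinearCode.weightCount_dual_RL hk3 hkq hkq hα' M
  have hpos : LinearCode.weightCount (LinearCode.RL k α M) (Fintype.card F + 2 - k) ≠ 0 := by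
    rw [hcount]
    exact (Nat.mul_pos (by omega) (LinearCode.minWeightSets_pos hcases M)).ne'
  have hd : LinearCode.minDist (LinearCode.RL k α M) = Fintype.card F + 2 - k :=
    LinearCode.minDist_eq_of_weightCount_ne_zero (by omega)
      (fun c hc hc0 => LinearCode.le_hammingNorm_RL hk3 hα' hc hc0) hpos
  have hd' : LinearCode.minDist (LinearCode.dual (LinearCode.RL k α M)) = k :=
    LinearCode.minDist_eq_of_weightCount_ne_zero (by omega)
      (fun x hx hx0 => LinearCode.le_hammingNorm_dual_RL hk3 hkq hα hx hx0) (hdual ▸ hpos)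
  have hdim := LinearCode.finrank_RL hk3 hkq hα' M
  have hdim' := LinearCode.finrank_dual (LinearCode.RL k α M)
  have hcard : Fintype.card (Fin (Fintype.card F) ⊕ Fin 2) = Fintype.card F + 2 := by simp
  rw [hdim, hcard] at hdim'
  refine ⟨⟨?_, ?_⟩, ⟨hcard, hdim, hd⟩, hd', ?_⟩
  · rw [LinearCode.singletonDefect, hdim, hd, hcard]
    omega
  · rw [LinearCode.singletonDefect, hdim', hd', hcard]
    omega
  intro A hA
  have hA' : A = (LinearCode.weightCount (LinearCode.RL k α M) (Fintype.card F + 2 - k) : ℚ) := by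
    rcases hA with h | h
    · exact h
    · rw [h, hdual]
  rw [hcount, LinearCode.card_minWeightSets, hM] at hA'
  simp only [Matrix.of_apply, Matrix.cons_val', Matrix.cons_val_zero, Matrix.cons_val_one,
    Matrix.cons_val_fin_one] at hA'
  have hq0 : (Fintype.card F : ℚ) ≠ 0 := by exact_mod_cast (by omega : Fintype.card F ≠ 0)
  push_cast [Nat.cast_sub hq1.le] at hA'
  -- The Li-Wan formulas give q times each count, so every case is compared after multiplying by q.
  have hqA : (Fintype.card F : ℚ) * A = (Fintype.card F - 1) *
      (Fintype.card F * LinearCode.scaledSumCount (k - 1) a₁₁ a₂₁ +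
        Fintype.card F * LinearCode.scaledSumCount (k - 1) a₁₂ a₂₂) := by
    rw [hA']; ring
  have hsign : ((-1) ^ (k + (k - 1) / p) : ℚ) = -(-1) ^ (k - 1 + (k - 1) / p) := by
    rw [show k + (k - 1) / p = k - 1 + (k - 1) / p + 1 by omega, pow_succ]
    ring
  rw [hsign]
  -- A column (a, b) asks for the sum b/a: nonzero for `e1`, zero for `e2`, impossible for `e3`.
  -- Each case of the theorem is a choice of type for both columns.
  have e1 : ∀ {a b : F}, a ≠ 0 → b ≠ 0 → _ :=
    fun ha hb => LinearCode.card_mul_scaledSumCount_of_ne_zero p (k - 1) ha hb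
  have e2 : ∀ {a b : F}, a ≠ 0 → b = 0 → _ :=
    fun ha hb => LinearCode.card_mul_scaledSumCount_zero p (k - 1) ha hb
  have e3 : ∀ {a b : F}, a = 0 → b ≠ 0 → _ :=
    fun ha hb => LinearCode.scaledSumCount_of_eq_zero (k - 1) ha hb
  have cancel : ∀ B : ℚ, (Fintype.card F : ℚ) * A = Fintype.card F * B → A = B :=
    fun B => mul_left_cancel₀ hq0
  refine ⟨fun hpk => ⟨?_, ?_⟩, fun hpk => ⟨?_, ?_, ?_, ?_⟩⟩
  · simp only [ne_eq, mul_eq_zero, not_or]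
    rintro (⟨⟨⟨h1, h2⟩, h3⟩, h4⟩ | ⟨⟨⟨h1, h2⟩, h3⟩, h4⟩ | ⟨⟨⟨h1, h2⟩, h4⟩, h3⟩) <;> apply cancel
    · rw [hqA, e1 h1 h3, e1 h2 h4, if_neg hpk]
      field_simp
      ring
    · rw [hqA, e1 h1 h3, e2 h2 h4, if_neg hpk]
      field_simp
      ring
    · rw [hqA, e2 h1 h3, e1 h2 h4, if_neg hpk]
      field_simp
      ring
  · simp only [ne_eq, mul_eq_zero, not_or]
    rintro (⟨⟨⟨h1, h3⟩, h4⟩, h2⟩ | ⟨⟨⟨h2, h3⟩, h4⟩, h1⟩ | ⟨⟨h2, h3⟩, h1, h4⟩ |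
      ⟨⟨h1, h4⟩, h2, h3⟩) <;> apply cancel
    · rw [hqA, e1 h1 h3, e3 h2 h4, if_neg hpk]
      field_simp
      ring
    · rw [hqA, e3 h1 h3, e1 h2 h4, if_neg hpk]
      field_simp
      ring
    · rw [hqA, e3 h1 h3, e2 h2 h4, if_neg hpk]
      field_simp
      ring
    · rw [hqA, e2 h1 h3, e3 h2 h4, if_neg hpk]
      field_simp
      ring
  · simp only [ne_eq, mul_eq_zero, not_or]
    rintro ⟨⟨⟨h1, h2⟩, h3⟩, h4⟩
    apply cancel
    rw [hqA, e1 h1 h3, e1 h2 h4, if_pos hpk]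
    field_simp
    ring
  · simp only [ne_eq, mul_eq_zero, not_or]
    rintro (⟨⟨⟨h1, h2⟩, h3⟩, h4⟩ | ⟨⟨⟨h1, h2⟩, h4⟩, h3⟩) <;> apply cancel
    · rw [hqA, e1 h1 h3, e2 h2 h4, if_pos hpk]
      field_simp
      ring
    · rw [hqA, e2 h1 h3, e1 h2 h4, if_pos hpk]
      field_simp
      ring
  · simp only [ne_eq, mul_eq_zero, not_or]
    rintro (⟨⟨⟨h1, h3⟩, h4⟩, h2⟩ | ⟨⟨⟨h2, h3⟩, h4⟩, h1⟩) <;> apply cancel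
    · rw [hqA, e1 h1 h3, e3 h2 h4, if_pos hpk]
      field_simp
      ring
    · rw [hqA, e3 h1 h3, e1 h2 h4, if_pos hpk]
      field_simp
      ring
  · simp only [ne_eq, mul_eq_zero, not_or]
    rintro (⟨⟨h2, h3⟩, h1, h4⟩ | ⟨⟨h1, h4⟩, h2, h3⟩) <;> apply cancel
    · rw [hqA, e3 h1 h3, e2 h2 h4, if_pos hpk]
      field_simp
      ring
    · rw [hqA, e2 h1 h3, e3 h2 h4, if_pos hpk]
      field_simp
      ring
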